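/- Let $\Bbbk$ be an algebraically closed field and let $R=\bigoplus_{\gamma\in\mathbb{R}_{\ge 0}}R_\gamma$ be an $\mathbb{R}_{\ge0}$-graded integral domain, finitely generated as a $\Bbbk$-algebra, with $R_0=\Bbbk$ and Krull dimension $n$. Let $M=\bigoplus_{\lambda\in\mathbb{R}}M_\lambda$ be a finitely generated $\mathbb{R}$-graded $R$-module. For $x\in\mathbb{R}$ put $M_{\le x}=\bigoplus_{\lambda\le x}M_\lambda$, and $R_{\le x}=\bigoplus_{\gamma\le x}R_\gamma$. Then $R_{\le x}$ and $M_{\le x}$ are finite-dimensional over $\Bbbk$ for every $x$, and there are real constants $a_n(R)$, $a_n(M)$, $a_{n-1}(M)$ such that, as $x\to\infty$, \[ \dim_\Bbbk R_{\le x}=\frac{a_n(R)}{n!}x^n+O(x^{n-1}),\qquad \dim_\Bbbk M_{\le x}=\frac{a_n(M)}{n!}x^n+O(x^{n-1}), \] and, if $n\ge 1$, \[ \lim_{T\to\infty}\frac{1}{T^n}\int_1^T\left(\dim_\Bbbk M_{\le x}-\frac{a_n(M)}{n!}x^n-\frac{a_{n-1}(M)}{(n-1)!}x^{n-1}\right)dx=0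 . \] Moreover $a_n(M)=\operatorname{rank}(M)\,a_n(R)$, where $\operatorname{rank}(M)$ is the rank of $M$ over the domain $R$, i.e. the dimension of $M\otimes_R\operatorname{Frac}(R)$ over $\operatorname{Frac}(R)$. -/

import Mathlib

open Filter Topology Asymptotics
open scoped Nat

/-- `M_{≤ x} = ⨁_{l ≤ x} M_l`, as a `k`-subspace of a module `M` graded by the subspaces `ℳ l`. -/
def gradedLE {k M : Type*} [Field k] [AddCommGroup M] [Module k M]
    (ℳ : ℝ → Submodule k M) (x : ℝ) : Submodule k M :=
  ⨆ l : ℝ, ⨆ _ : l ≤ x, ℳ l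

/-- The counting function `x ↦ dim_k M_{≤ x}`. -/
noncomputable def dimLE {k M : Type*} [Field k] [AddCommGroup M] [Module k M]
    (ℳ : ℝ → Submodule k M) (x : ℝ) : ℝ :=
  (Module.finrank k (gradedLE ℳ x) : ℝ)

/-- `f x = (a / n!) x ^ n + O (x ^ (n - 1))` as `x → ∞`; the exponent `n - 1` is an integer. -/
def HasLeadingTerm (f : ℝ → ℝ) (n : ℕ) (a : ℝ) : Prop :=
  (fun x : ℝ => f x - a / (n ! : ℝ) * x ^ n) =O[atTop] (fun x : ℝ => x ^ ((n : ℤ) - 1))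

/-- `f x - (a / n!) x ^ n - (b / (n - 1)!) x ^ (n - 1)` (used only for `1 ≤ n`). -/
noncomputable def twoTermRemainder (f : ℝ → ℝ) (n : ℕ) (a b : ℝ) (x : ℝ) : ℝ :=
  f x - a / (n ! : ℝ) * x ^ n - b / ((n - 1)! : ℝ) * x ^ (n - 1)

/-- The remainder is integrable on every `[1, T]`, and
`T ^ (-n) * ∫_1^T (remainder) → 0` as `T → ∞`. -/
def HasCesaroSecondTerm (f : ℝ → ℝ) (n : ℕ) (a b : ℝ) : Prop :=
  (∀ T : ℝ, 1 ≤ T →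
    IntervalIntegrable (twoTermRemainder f n a b) MeasureTheory.volume 1 T) ∧
  Tendsto (fun T : ℝ => 1 / T ^ n * ∫ x in (1 : ℝ)..T, twoTermRemainder f n a b x)
    atTop (𝓝 0)

/-! A counting function over a real grading is a staircase and need not have a second term
pointwise, but its primitive does. `HasExpansion` records one term for f and two for its primitive.
It survives sums, shifts of the argument, and solving f(x) = g(x) + f(x - d), which raises the
degree by one and divides the leading coefficient by d (`HasExpansion.of_step`).

Algebra supplies exactly these operations. A finitely generated graded module has a filtration whose
factors are shifts of R/q, q a homogeneous prime (`homogeneous_submodule_induction`), and truncated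
dimensions add along it. If p is a homogeneous prime missing a homogeneous f of degree d > 0,
multiplication by f is injective on R/p, so the counting function of R/p solves the difference
equation with g that of R/(p + (f)). The factors of the latter are R/q with q strictly above p, and
induction on coheight applies.

Rank and the coefficient of x^n are both additive along the filtration of M: a factor with q = 0
contributes 1 and a_n(R), any other is torsion and of smaller degree. -/

/-! ### Growth of solutions of difference equations -/

theorem abs_le_add_of_step {d X B : ℝ} (hd : 0 < d) {e A : ℝ → ℝ}
    (hstep : ∀ x, X ≤ x → |e x - e (x - d)| ≤ A x - A (x - d))
    (hinit : ∀ x ∈ Set.Icc (X - d) X, |e x| ≤ A x + B) {x : ℝ} (hx : X ≤ x) :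
    |e x| ≤ A x + B := by
  -- N bounds the number of steps of length d needed to descend into the window [X - d, X].
  have key : ∀ (N : ℕ) (x : ℝ), X - d ≤ x → x ≤ X + N * d → |e x| ≤ A x + B := by
    intro N
    induction N with
    | zero => intro x h1 h2; exact hinit x ⟨h1, by simpa using h2⟩
    | succ N ih =>
      intro x h1 h2
      rcases le_total x X with h | h
      · exact hinit x ⟨h1, h⟩
      · have h3 := ih (x - d) (by linarith) (by push_cast at h2; linarith)
        have h4 := hstep x h
        have h5 : |e x| ≤ |e x - e (x - d)| + |e (x - d)| := by
          simpa using abs_add_le (e x - e (x - d)) (e (x - d))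
        linarith
  obtain ⟨N, hN⟩ := exists_nat_ge ((x - X) / d)
  refine key N x (by linarith) ?_
  rw [div_le_iff₀ hd] at hN
  linarith

theorem mul_pow_le_pow_sub_pow {d x : ℝ} (hd : 0 < d) (hx : d ≤ x) (m : ℕ) :
    d * x ^ m ≤ x ^ (m + 1) - (x - d) ^ (m + 1) := by
  have h : (x - d) ^ m ≤ x ^ m := pow_le_pow_left₀ (by linarith) (by linarith) m
  have h2 : (x - d) * (x - d) ^ m ≤ (x - d) * x ^ m :=
    mul_le_mul_of_nonneg_left h (by linarith)
  rw [pow_succ', pow_succ']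
  linarith

/-- A real function that is bounded on every compact interval. -/
def LocallyBounded (e : ℝ → ℝ) : Prop :=
  ∀ a b : ℝ, ∃ B : ℝ, ∀ x ∈ Set.Icc a b, |e x| ≤ B

theorem Monotone.locallyBounded {f : ℝ → ℝ} (hf : Monotone f) : LocallyBounded f :=
  fun a b => ⟨max |f a| |f b|, fun _ hx => abs_le_max_abs_abs (hf hx.1) (hf hx.2)⟩

theorem Continuous.locallyBounded {f : ℝ → ℝ} (hf : Continuous f) : LocallyBounded f := by
  intro a b
  obtain ⟨B, hB⟩ := isCompact_Icc.exists_bound_of_continuousOn (s := Set.Icc a b) hf.continuousOn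
  exact ⟨B, hB⟩

theorem LocallyBounded.sub {f g : ℝ → ℝ} (hf : LocallyBounded f) (hg : LocallyBounded g) :
    LocallyBounded fun x => f x - g x := by
  intro a b
  obtain ⟨B, hB⟩ := hf a b
  obtain ⟨C, hC⟩ := hg a b
  exact ⟨B + C, fun x hx => (abs_sub _ _).trans (add_le_add (hB x hx) (hC x hx))⟩

/-- Increments telescope. The factor m matters for m = 0: the increments then vanish eventually and
e is bounded, whereas increments of order 1/x could leave a logarithm. -/
theorem isBigO_pow_of_step {d : ℝ} (hd : 0 < d) {e : ℝ → ℝ} (he : LocallyBounded e) {m : ℕ}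
    (h : (fun x => e x - e (x - d)) =O[atTop] fun x => (m : ℝ) * x ^ (m - 1)) :
    e =O[atTop] fun x => x ^ m := by
  obtain ⟨C, hC, hb⟩ := h.exists_nonneg
  obtain ⟨X₀, hX₀⟩ := eventually_atTop.1 hb.bound
  set X := max X₀ (max d 1)
  have hXd : d ≤ X := (le_max_left _ _).trans (le_max_right _ _)
  have hX1 : 1 ≤ X := (le_max_right _ _).trans (le_max_right _ _)
  obtain ⟨B, hB⟩ := he (X - d) X
  set D := C * m / d
  have hD : 0 ≤ D := by positivity
  have hb' : ∀ x, X ≤ x → |e x| ≤ D * x ^ m + B := by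
    intro x hx
    refine abs_le_add_of_step hd (A := fun x => D * x ^ m) ?_ ?_ hx
    · intro y hy
      refine (hX₀ y ((le_max_left _ _).trans hy)).trans ?_
      have hy0 : 0 ≤ y := by linarith
      rw [Real.norm_of_nonneg (by positivity), ← mul_sub]
      cases m with
      | zero => simp
      | succ k =>
        have := mul_le_mul_of_nonneg_left (mul_pow_le_pow_sub_pow hd (hXd.trans hy) k) hD
        refine le_trans (le_of_eq ?_) this
        simp only [D, Nat.add_sub_cancel]
        field_simp
    · intro y hy
      have : 0 ≤ D * y ^ m := mul_nonneg hD (pow_nonneg (by linarith [hy.1]) _)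
      linarith [hB y hy]
  have hB0 : 0 ≤ B := (abs_nonneg _).trans (hB X ⟨by linarith, le_rfl⟩)
  refine IsBigO.of_bound (D + B) (eventually_atTop.2 ⟨X, fun x hx => ?_⟩)
  have h1 : 1 ≤ x ^ m := one_le_pow₀ (hX1.trans hx)
  rw [Real.norm_of_nonneg (by linarith : (0 : ℝ) ≤ x ^ m)]
  refine (hb' x hx).trans ?_
  nlinarith

theorem isLittleO_pow_of_step {d : ℝ} (hd : 0 < d) {e : ℝ → ℝ} (he : LocallyBounded e) {m : ℕ}
    (h : (fun x => e x - e (x - d)) =o[atTop] fun x => x ^ m) :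
    e =o[atTop] fun x => x ^ (m + 1) := by
  refine IsLittleO.of_bound fun ε hε => ?_
  obtain ⟨X₀, hX₀⟩ := eventually_atTop.1 (h.bound (show 0 < ε / 2 * d by positivity))
  set X := max X₀ d
  have hXd : d ≤ X := le_max_right _ _
  obtain ⟨B, hB⟩ := he (X - d) X
  have hb' : ∀ x, X ≤ x → |e x| ≤ ε / 2 * x ^ (m + 1) + B := by
    intro x hx
    refine abs_le_add_of_step hd (A := fun x => ε / 2 * x ^ (m + 1)) ?_ ?_ hx
    · intro y hy
      refine (hX₀ y ((le_max_left _ _).trans hy)).trans ?_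
      have hy0 : 0 ≤ y := by linarith
      rw [Real.norm_of_nonneg (by positivity), ← mul_sub, mul_assoc]
      exact mul_le_mul_of_nonneg_left (mul_pow_le_pow_sub_pow hd (hXd.trans hy) m) (by positivity)
    · intro y hy
      have : 0 ≤ ε / 2 * y ^ (m + 1) := mul_nonneg (by positivity) (pow_nonneg (by linarith [hy.1]) _)
      linarith [hB y hy]
  have htop : Tendsto (fun x : ℝ => ε / 2 * x ^ (m + 1)) atTop atTop :=
    (tendsto_pow_atTop (Nat.succ_ne_zero m)).const_mul_atTop (by positivity)
  filter_upwards [eventually_ge_atTop X, htop.eventually_ge_atTop B] with x hx hxB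
  rw [Real.norm_of_nonneg (pow_nonneg (by linarith) _ : (0 : ℝ) ≤ x ^ (m + 1))]
  refine (hb' x hx).trans ?_
  linarith

/-! ### Expansions of shifted powers -/

theorem isLittleO_pow_atTop {p q : ℕ} (h : p < q) :
    (fun x : ℝ => x ^ p) =o[atTop] fun x : ℝ => x ^ q :=
  isLittleO_pow_pow_atTop_of_lt h

theorem isBigO_sub_const_atTop (s : ℝ) : (fun x : ℝ => x - s) =O[atTop] fun x : ℝ => x :=
  (isBigO_refl _ _).sub (isLittleO_const_id_atTop s).isBigO

/-- Binomial expansion to second order, with κ = (m + 2)(m + 1)/2 * s^2; the induction multiplies by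
x - s. -/
theorem exists_sub_pow_expansion (s : ℝ) (m : ℕ) : ∃ κ : ℝ,
    (fun x : ℝ => (x - s) ^ (m + 2) - x ^ (m + 2) + (m + 2) * s * x ^ (m + 1) - κ * x ^ m)
      =o[atTop] fun x : ℝ => x ^ m := by
  induction m with
  | zero =>
    refine ⟨s ^ 2, ?_⟩
    refine (isLittleO_zero _ _).congr_left fun x => ?_
    push_cast
    ring
  | succ m ih =>
    obtain ⟨κ, hκ⟩ := ih
    refine ⟨κ + (m + 2) * s ^ 2, ?_⟩
    have h1 := (isBigO_sub_const_atTop s).mul_isLittleO hκ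
    have h2 := (isLittleO_pow_atTop (Nat.lt_succ_self m)).const_mul_left (-(s * κ))
    have h1' : (fun x : ℝ => (x - s) * ((x - s) ^ (m + 2) - x ^ (m + 2) + (m + 2) * s * x ^ (m + 1)
        - κ * x ^ m)) =o[atTop] fun x : ℝ => x ^ (m + 1) :=
      h1.congr_right fun x => (pow_succ' x m).symm
    refine (h1'.add h2).congr_left fun x => ?_
    push_cast
    ring

theorem sub_pow_expansion (s : ℝ) (n : ℕ) :
    (fun x : ℝ => (x - s) ^ (n + 1) - x ^ (n + 1) + (n + 1) * s * x ^ n)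
      =O[atTop] fun x : ℝ => (n : ℝ) * x ^ (n - 1) := by
  cases n with
  | zero =>
    refine (isBigO_zero _ _).congr_left fun x => ?_
    push_cast
    ring
  | succ m =>
    obtain ⟨κ, hκ⟩ := exists_sub_pow_expansion s m
    have h := hκ.isBigO.add (isBigO_const_mul_self κ (fun x : ℝ => x ^ m) atTop)
    have h' := h.trans (isBigO_self_const_mul (c := ((m + 1 : ℕ) : ℝ)) (by positivity)
      (fun x : ℝ => x ^ m) atTop)
    refine h'.congr_left fun x => ?_
    push_cast
    ring

/-- A constant is negligible for n ≥ 1, but for n = 0 it must be absorbed into the second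
coefficient. -/
theorem isLittleO_const_sub_pow (c : ℝ) (n : ℕ) : ∃ b : ℝ,
    (fun x : ℝ => c - b / (n ! : ℝ) * x ^ n) =o[atTop] fun x : ℝ => x ^ n := by
  cases n with
  | zero => exact ⟨c, by simp⟩
  | succ n =>
    refine ⟨0, ?_⟩
    simpa using (isLittleO_pow_atTop (Nat.succ_pos n)).const_mul_left c

theorem isLittleO_natCast_mul_pow_sub_one (n : ℕ) :
    (fun x : ℝ => (n : ℝ) * x ^ (n - 1)) =o[atTop] fun x : ℝ => x ^ n := by
  cases n with
  | zero => simp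
  | succ n => exact (isLittleO_pow_atTop (Nat.lt_succ_self n)).const_mul_left _

/-- A monotone function with a leading term of degree `n` and coefficient `a / n!`, whose primitive
has an expansion with two terms. -/
structure HasExpansion (n : ℕ) (a : ℝ) (f : ℝ → ℝ) : Prop where
  mono : Monotone f
  lead : (fun x => f x - a / (n ! : ℝ) * x ^ n) =O[atTop] fun x => (n : ℝ) * x ^ (n - 1)
  primitive : ∃ b : ℝ, (fun T => (∫ x in (0 : ℝ)..T, f x) - a / ((n + 1)! : ℝ) * T ^ (n + 1)
    - b / (n ! : ℝ) * T ^ n) =o[atTop] fun T => T ^ n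

/-! ### Operations on functions with an expansion -/

namespace HasExpansion

variable {n : ℕ} {a a' : ℝ} {f g : ℝ → ℝ}

theorem intervalIntegrable (h : HasExpansion n a f) (s t : ℝ) :
    IntervalIntegrable f MeasureTheory.volume s t :=
  h.mono.intervalIntegrable

theorem zero (n : ℕ) : HasExpansion n 0 fun _ => 0 where
  mono := monotone_const
  lead := by exact (isBigO_zero _ _).congr_left fun x => by simp
  primitive := ⟨0, by simp⟩

theorem add (hf : HasExpansion n a f) (hg : HasExpansion n a' g) :
    HasExpansion n (a + a') fun x => f x + g x where
  mono := hf.mono.add hg.mono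
  lead := (hf.lead.add hg.lead).congr_left fun x => by ring
  primitive := by
    obtain ⟨b, hb⟩ := hf.primitive
    obtain ⟨b', hb'⟩ := hg.primitive
    refine ⟨b + b', (hb.add hb').congr_left fun T => ?_⟩
    rw [intervalIntegral.integral_add (hf.intervalIntegrable _ _) (hg.intervalIntegrable _ _)]
    ring

theorem succ (hf : HasExpansion n a f) : HasExpansion (n + 1) 0 f where
  mono := hf.mono
  lead := by
    have h1 : (fun x : ℝ => a / (n ! : ℝ) * x ^ n) =O[atTop] fun x : ℝ => x ^ n :=
      isBigO_const_mul_self _ _ _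
    have h2 := (hf.lead.trans (isLittleO_natCast_mul_pow_sub_one n).isBigO).add h1
    refine (h2.trans (isBigO_self_const_mul (c := ((n + 1 : ℕ) : ℝ)) (by positivity)
      (fun x : ℝ => x ^ n) atTop)).congr_left fun x => ?_
    ring
  primitive := by
    obtain ⟨b, hb⟩ := hf.primitive
    -- The leading term of the primitive in degree n is its second term in degree n + 1.
    refine ⟨a, ?_⟩
    have h1 := (isLittleO_pow_atTop (Nat.lt_succ_self n)).const_mul_left (b / (n ! : ℝ))
    refine ((hb.trans (isLittleO_pow_atTop (Nat.lt_succ_self n))).add h1).congr_left fun T => ?_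
    ring

theorem of_lt {m : ℕ} (hf : HasExpansion n a f) (h : n < m) : HasExpansion m 0 f := by
  induction m, h using Nat.le_induction with
  | base => exact hf.succ
  | succ m _ ih => exact ih.succ

theorem comp_sub_const (hf : HasExpansion n a f) (s : ℝ) :
    HasExpansion n a fun x => f (x - s) where
  mono := fun x y hxy => hf.mono (by linarith)
  lead := by
    have ht : Tendsto (fun x : ℝ => x - s) atTop atTop := tendsto_atTop_add_const_right _ _ tendsto_id
    have h1 := hf.lead.comp_tendsto ht
    have h2 : (fun x : ℝ => (n : ℝ) * (x - s) ^ (n - 1)) =O[atTop] fun x => (n : ℝ) * x ^ (n - 1) :=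
      (isBigO_refl _ _).mul ((isBigO_sub_const_atTop s).pow _)
    have h3 : (fun x : ℝ => (x - s) ^ n - x ^ n) =O[atTop] fun x => (n : ℝ) * x ^ (n - 1) := by
      cases n with
      | zero => exact (isBigO_zero _ _).congr_left fun x => by simp
      | succ m =>
        have := ((sub_pow_expansion s m).trans (isLittleO_natCast_mul_pow_sub_one m).isBigO).sub
          (isBigO_const_mul_self ((m + 1) * s) (fun x : ℝ => x ^ m) atTop)
        refine (this.trans (isBigO_self_const_mul (c := ((m + 1 : ℕ) : ℝ)) (by positivity)
          (fun x : ℝ => x ^ m) atTop)).congr_left fun x => ?_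
        ring
    refine ((h1.trans h2).add (h3.const_mul_left (a / (n ! : ℝ)))).congr_left fun x => ?_
    simp only [Function.comp_apply]
    ring
  primitive := by
    obtain ⟨b, hb⟩ := hf.primitive
    have ht : Tendsto (fun x : ℝ => x - s) atTop atTop := tendsto_atTop_add_const_right _ _ tendsto_id
    have h1 : (fun T => (∫ x in (0 : ℝ)..(T - s), f x) - a / ((n + 1)! : ℝ) * (T - s) ^ (n + 1)
        - b / (n ! : ℝ) * (T - s) ^ n) =o[atTop] fun T => T ^ n :=
      (hb.comp_tendsto ht).trans_isBigO ((isBigO_sub_const_atTop s).pow _)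
    obtain ⟨c, hc⟩ := isLittleO_const_sub_pow (∫ x in (-s)..0, f x) n
    have h3 : (fun x : ℝ => (x - s) ^ (n + 1) - x ^ (n + 1) + (n + 1) * s * x ^ n)
        =o[atTop] fun x => x ^ n := (sub_pow_expansion s n).trans_isLittleO
          (isLittleO_natCast_mul_pow_sub_one n)
    have h4 : (fun x : ℝ => (x - s) ^ n - x ^ n) =o[atTop] fun x => x ^ n := by
      cases n with
      | zero => simp
      | succ m =>
        have := ((sub_pow_expansion s m).trans (isLittleO_natCast_mul_pow_sub_one m).isBigO).sub
          (isBigO_const_mul_self ((m + 1) * s) (fun x : ℝ => x ^ m) atTop)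
        refine (this.trans_isLittleO (isLittleO_pow_atTop (Nat.lt_succ_self m))).congr_left
          fun x => ?_
        ring
    -- c accounts for the integral over [-s, 0], and -a * s for the second term of (T - s)^(n + 1).
    refine ⟨b + c - a * s, (((h1.add hc).add (h3.const_mul_left (a / ((n + 1)! : ℝ)))).add
      (h4.const_mul_left (b / (n ! : ℝ)))).congr_left fun T => ?_⟩
    have h5 : ∫ x in (0 : ℝ)..T, f (x - s)
        = (∫ x in (-s)..0, f x) + ∫ x in (0 : ℝ)..(T - s), f x := by
      rw [intervalIntegral.integral_comp_sub_right, zero_sub,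
        intervalIntegral.integral_add_adjacent_intervals (hf.intervalIntegrable _ _)
          (hf.intervalIntegrable _ _)]
    rw [h5, Nat.factorial_succ]
    push_cast
    field_simp
    ring

/-- Since f vanishes on the negative axis, its primitive F satisfies F(T) - F(T - d) = ∫_0^T g.
Subtracting from F a polynomial that solves this up to o(T^n) leaves an error that telescopes to
o(T^(n + 1)). -/
theorem of_step {d : ℝ} (hd : 0 < d) (hf : Monotone f) (hf0 : ∀ x < 0, f x = 0)
    (hg : HasExpansion n a g) (hfg : ∀ x, f x = g x + f (x - d)) :
    HasExpansion (n + 1) (a / d) f where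
  mono := hf
  lead := by
    have hp : LocallyBounded fun x : ℝ => a / d / ((n + 1)! : ℝ) * x ^ (n + 1) :=
      (by fun_prop : Continuous fun x : ℝ => a / d / ((n + 1)! : ℝ) * x ^ (n + 1)).locallyBounded
    have h := isBigO_pow_of_step hd (hf.locallyBounded.sub hp) (m := n) <|
      (hg.lead.add ((sub_pow_expansion d n).const_mul_left (a / d / ((n + 1)! : ℝ)))).congr_left
        fun x => by
          rw [hfg x, Nat.factorial_succ]
          push_cast
          field_simp
          ring
    exact h.trans (isBigO_self_const_mul (c := ((n + 1 : ℕ) : ℝ)) (by positivity)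
      (fun x : ℝ => x ^ n) atTop)
  primitive := by
    obtain ⟨b, hb⟩ := hg.primitive
    obtain ⟨κ, hκ⟩ := exists_sub_pow_expansion d n
    set α : ℝ := a / d / ((n + 2)! : ℝ) with hα
    -- Matches the coefficients of T^n: the difference of α * T^(n + 2) already contributes -α * κ
    -- there.
    set β : ℝ := (b / (n ! : ℝ) + α * κ) / (d * (n + 1)) with hβ
    refine ⟨β * ((n + 1)! : ℝ), ?_⟩
    have hint : ∀ s t : ℝ, IntervalIntegrable f MeasureTheory.volume s t :=
      fun s t => hf.intervalIntegrable
    have hF : LocallyBounded fun T => ∫ x in (0 : ℝ)..T, f x :=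
      (intervalIntegral.continuous_primitive hint 0).locallyBounded
    have hp : LocallyBounded fun x : ℝ => α * x ^ (n + 2) :=
      (by fun_prop : Continuous fun x : ℝ => α * x ^ (n + 2)).locallyBounded
    have hq : LocallyBounded fun x : ℝ => β * x ^ (n + 1) :=
      (by fun_prop : Continuous fun x : ℝ => β * x ^ (n + 1)).locallyBounded
    have h3 : (fun x : ℝ => (x - d) ^ (n + 1) - x ^ (n + 1) + (n + 1) * d * x ^ n)
        =o[atTop] fun x => x ^ n := (sub_pow_expansion d n).trans_isLittleO
          (isLittleO_natCast_mul_pow_sub_one n)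
    have hstep : ∀ T : ℝ, (∫ x in (0 : ℝ)..T, f x) - (∫ x in (0 : ℝ)..(T - d), f x)
        = ∫ x in (0 : ℝ)..T, g x := by
      intro T
      have e1 : ∫ x in (0 : ℝ)..T, f x
          = (∫ x in (0 : ℝ)..T, g x) + ∫ x in (0 : ℝ)..T, f (x - d) := by
        rw [← intervalIntegral.integral_add (hg.intervalIntegrable _ _)]
        · exact intervalIntegral.integral_congr fun x _ => hfg x
        · exact Monotone.intervalIntegrable fun x y hxy => hf (by linarith)
      have e2 : ∫ x in (-d)..0, f x = 0 := by
        rw [intervalIntegral.integral_of_le (by linarith),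
          MeasureTheory.integral_Ioc_eq_integral_Ioo]
        exact MeasureTheory.setIntegral_eq_zero_of_forall_eq_zero fun x hx => hf0 x hx.2
      rw [e1, intervalIntegral.integral_comp_sub_right, zero_sub,
        ← intervalIntegral.integral_add_adjacent_intervals (hint (-d) 0) (hint 0 (T - d)), e2]
      ring
    have h := isLittleO_pow_of_step hd ((hF.sub hp).sub hq) (m := n) <|
      ((hb.add (hκ.const_mul_left α)).add (h3.const_mul_left β)).congr_left fun T => by
        rw [← hstep T]
        have e1 : a / ((n + 1)! : ℝ) = α * ((n + 2) * d) := by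
          rw [hα, Nat.factorial_succ (n + 1)]
          push_cast
          field_simp
          ring
        have e2 : b / (n ! : ℝ) = β * ((n + 1) * d) - α * κ := by
          rw [hβ]
          field_simp
          ring
        rw [e1, e2]
        ring
    refine h.congr_left fun T => ?_
    rw [mul_div_cancel_right₀ _ (by positivity : ((n + 1)! : ℝ) ≠ 0)]

theorem of_const_on_nonneg (c : ℝ) (hf : Monotone f) (hc : ∀ x, 0 ≤ x → f x = c) :
    HasExpansion 0 c f where
  mono := hf
  lead := by
    refine (EventuallyEq.isBigO ?_ : _ =O[atTop] fun _ : ℝ => (0 : ℝ)).trans (isBigO_zero _ _)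
    filter_upwards [eventually_ge_atTop 0] with x hx
    simp [hc x hx]
  primitive := by
    refine ⟨0, (EventuallyEq.trans_isLittleO ?_ (isLittleO_zero _ _) :
      _ =o[atTop] fun T : ℝ => T ^ 0)⟩
    filter_upwards [eventually_ge_atTop 0] with T hT
    have : ∫ x in (0 : ℝ)..T, f x = ∫ x in (0 : ℝ)..T, c := by
      refine intervalIntegral.integral_congr fun x hx => hc x ?_
      rw [Set.uIcc_of_le hT] at hx
      exact hx.1
    rw [this]
    simp [mul_comm]

theorem hasLeadingTerm (h : HasExpansion n a f) : HasLeadingTerm f n a := by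
  refine h.lead.trans ?_
  cases n with
  | zero => exact (isBigO_zero _ _).congr_left fun x => by simp
  | succ n => simpa using isBigO_const_mul_self ((n : ℝ) + 1) (fun x : ℝ => x ^ n) atTop

theorem exists_hasCesaroSecondTerm (h : HasExpansion n a f) :
    ∃ b : ℝ, 1 ≤ n → HasCesaroSecondTerm f n a b := by
  cases n with
  | zero => exact ⟨0, fun h => absurd h (by norm_num)⟩
  | succ n =>
    obtain ⟨b, hb⟩ := h.primitive
    refine ⟨b, fun _ => ⟨fun T _ => ?_, ?_⟩⟩
    · have hp : Continuous fun x : ℝ => a / ((n + 1)! : ℝ) * x ^ (n + 1) := by fun_prop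
      have hq : Continuous fun x : ℝ => b / ((n + 1 - 1)! : ℝ) * x ^ (n + 1 - 1) := by fun_prop
      exact ((h.intervalIntegrable 1 T).sub (hp.intervalIntegrable 1 T)).sub
        (hq.intervalIntegrable 1 T)
    · have hp : Continuous fun x : ℝ => a / ((n + 1)! : ℝ) * x ^ (n + 1) := by fun_prop
      have hq : Continuous fun x : ℝ => b / ((n + 1 - 1)! : ℝ) * x ^ (n + 1 - 1) := by fun_prop
      have key : (fun T : ℝ => ∫ x in (1 : ℝ)..T, twoTermRemainder f (n + 1) a b x)
          =o[atTop] fun T : ℝ => T ^ (n + 1) := by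
        -- The constants left by starting the integration at 1 instead of 0.
        have hconst : (fun _ : ℝ => a / ((n + 2)! : ℝ) + b / ((n + 1)! : ℝ)
            - ∫ x in (0 : ℝ)..1, f x) =o[atTop] fun T : ℝ => T ^ (n + 1) := by
          simpa using (isLittleO_pow_atTop (Nat.succ_pos n)).const_mul_left
            (a / ((n + 2)! : ℝ) + b / ((n + 1)! : ℝ) - ∫ x in (0 : ℝ)..1, f x)
        refine (hb.add hconst).congr_left fun T => ?_
        have e1 : ∫ x in (1 : ℝ)..T, f x = (∫ x in (0 : ℝ)..T, f x) - ∫ x in (0 : ℝ)..1, f x :=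
          (intervalIntegral.integral_interval_sub_left (h.intervalIntegrable _ _)
            (h.intervalIntegrable _ _)).symm
        unfold twoTermRemainder
        rw [intervalIntegral.integral_sub
            ((h.intervalIntegrable 1 T).sub (hp.intervalIntegrable 1 T)) (hq.intervalIntegrable 1 T),
          intervalIntegral.integral_sub (h.intervalIntegrable 1 T) (hp.intervalIntegrable 1 T), e1,
          intervalIntegral.integral_const_mul, intervalIntegral.integral_const_mul,
          integral_pow, integral_pow, Nat.factorial_succ (n + 1), Nat.add_sub_cancel,
          Nat.factorial_succ n]
        push_cast
        field_simp
        ring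
      refine (key.tendsto_div_nhds_zero).congr fun T => ?_
      ring

end HasExpansion

open DirectSum

/-! ### Truncation of elements by degree -/

section Truncation

variable {k M : Type*} [Field k] [AddCommGroup M] [Module k M]
  (ℳ : ℝ → Submodule k M)

theorem gradedLE_mono : Monotone (gradedLE ℳ) := fun _ _ hxy =>
  iSup₂_le fun l hl => le_iSup₂_of_le l (hl.trans hxy) le_rfl

variable [DirectSum.Decomposition ℳ]

/-- The sum of the components of degree at most `x`. -/
noncomputable def truncLE (x : ℝ) (u : M) : M :=
  (decompose ℳ).symm (DFinsupp.filter (fun i => i ≤ x) (decompose ℳ u))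

theorem decompose_truncLE (x : ℝ) (u : M) (i : ℝ) :
    (decompose ℳ (truncLE ℳ x u) i : M) = if i ≤ x then (decompose ℳ u i : M) else 0 := by
  rw [truncLE, Equiv.apply_symm_apply]
  erw [DFinsupp.filter_apply]
  split_ifs <;> rfl

theorem eq_of_decompose_eq {u v : M}
    (h : ∀ i, (decompose ℳ u i : M) = (decompose ℳ v i : M)) : u = v :=
  (decompose ℳ).injective (DFinsupp.ext fun i => Subtype.ext (h i))

theorem truncLE_add (x : ℝ) (u v : M) :
    truncLE ℳ x (u + v) = truncLE ℳ x u + truncLE ℳ x v := by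
  refine eq_of_decompose_eq ℳ fun i => ?_
  rw [decompose_add, DirectSum.add_apply, Submodule.coe_add, decompose_truncLE, decompose_truncLE,
    decompose_truncLE, decompose_add, DirectSum.add_apply, Submodule.coe_add]
  split_ifs <;> simp

theorem mem_gradedLE_iff {x : ℝ} {u : M} :
    u ∈ gradedLE ℳ x ↔ ∀ i, x < i → (decompose ℳ u i : M) = 0 := by
  classical
  constructor
  · let S : Submodule k M :=
      { carrier := {u | ∀ i, x < i → (decompose ℳ u i : M) = 0}
        add_mem' := fun {u v} hu hv i hi => by
          rw [decompose_add, DirectSum.add_apply, Submodule.coe_add, hu i hi, hv i hi, add_zero]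
        zero_mem' := fun i _ => by simp
        smul_mem' := fun c u hu i hi => by
          rw [decompose_smul, DirectSum.smul_apply, Submodule.coe_smul, hu i hi, smul_zero] }
    have : gradedLE ℳ x ≤ S := iSup₂_le fun l hl u hu i hi =>
      decompose_of_mem_ne ℳ hu (hl.trans_lt hi).ne
    exact fun h => this h
  · intro h
    rw [← sum_support_decompose ℳ u]
    refine Submodule.sum_mem _ fun i _ => ?_
    rcases le_or_gt i x with hi | hi
    · exact (le_iSup₂_of_le i hi le_rfl : ℳ i ≤ gradedLE ℳ x) (decompose ℳ u i).2
    · rw [h i hi]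
      exact zero_mem _

theorem truncLE_mem_gradedLE (x : ℝ) (u : M) : truncLE ℳ x u ∈ gradedLE ℳ x :=
  (mem_gradedLE_iff ℳ).2 fun i hi => by rw [decompose_truncLE, if_neg hi.not_ge]

theorem truncLE_eq_self {x : ℝ} {u : M} (hu : u ∈ gradedLE ℳ x) : truncLE ℳ x u = u := by
  refine eq_of_decompose_eq ℳ fun i => ?_
  rw [decompose_truncLE]
  split_ifs with hi
  · rfl
  · exact ((mem_gradedLE_iff ℳ).1 hu i (not_le.1 hi)).symm

theorem Submodule.IsHomogeneous.truncLE_mem {R : Type*} [Semiring R] [Module R M]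
    {N : Submodule R M} (hN : N.IsHomogeneous ℳ) (x : ℝ) {u : M} (hu : u ∈ N) :
    truncLE ℳ x u ∈ N := by
  refine (hN.mem_iff ℳ).2 fun i => ?_
  rw [decompose_truncLE]
  split_ifs
  · exact hN i hu
  · exact zero_mem _

end Truncation

/-! ### Homogeneous colon ideals and prime filtrations -/

section GradedModule

variable {k R M : Type*} [Field k] [CommRing R] [Algebra k R]
  [AddCommGroup M] [Module k M] [Module R M]

section

variable (𝒜 : ℝ → Submodule k R) [GradedAlgebra 𝒜]
  (ℳ : ℝ → Submodule k M) [DirectSum.Decomposition ℳ] [SetLike.GradedSMul 𝒜 ℳ]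

theorem decompose_smul_of_mem (r : R) {m : M} {δ : ℝ} (hm : m ∈ ℳ δ) (j : ℝ) :
    (decompose ℳ (r • m) j : M) = (decompose 𝒜 r (j - δ) : R) • m := by
  induction r using DirectSum.Decomposition.inductionOn 𝒜 with
  | zero => simp
  | @homogeneous i r =>
    have hmem : (r : R) • m ∈ ℳ (i + δ) := SetLike.GradedSMul.smul_mem r.2 hm
    by_cases h : i + δ = j
    · subst h
      rw [decompose_of_mem_same ℳ hmem, add_sub_cancel_right, decompose_of_mem_same 𝒜 r.2]
    · rw [decompose_of_mem_ne ℳ hmem h, decompose_of_mem_ne 𝒜 r.2 (fun h' => h (by linarith)),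
        zero_smul]
  | add r s hr hs =>
    rw [add_smul, decompose_add, DirectSum.add_apply, Submodule.coe_add, hr, hs, decompose_add, DirectSum.add_apply,
      Submodule.coe_add, add_smul]

theorem truncLE_smul_of_mem (r : R) {m : M} {δ : ℝ} (hm : m ∈ ℳ δ) (x : ℝ) :
    truncLE ℳ x (r • m) = truncLE 𝒜 (x - δ) r • m := by
  refine eq_of_decompose_eq ℳ fun i => ?_
  rw [decompose_truncLE, decompose_smul_of_mem 𝒜 ℳ _ hm, decompose_smul_of_mem 𝒜 ℳ _ hm,
    decompose_truncLE]
  by_cases h : i ≤ x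
  · rw [if_pos h, if_pos (by linarith)]
  · rw [if_neg h, if_neg (by linarith), zero_smul]

theorem Submodule.IsHomogeneous.colon {N : Submodule R M} (hN : N.IsHomogeneous ℳ) {m : M} {δ : ℝ}
    (hm : m ∈ ℳ δ) : Submodule.IsHomogeneous (N.colon {m}) 𝒜 := by
  intro i r hr
  rw [Submodule.mem_colon_singleton] at hr ⊢
  have := hN (i + δ) hr
  rwa [decompose_smul_of_mem 𝒜 ℳ _ hm, add_sub_cancel_right] at this

end

theorem Submodule.IsHomogeneous.sup_span_singleton
    (𝒜 : ℝ → Submodule k R) [GradedAlgebra 𝒜]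
    (ℳ : ℝ → Submodule k M) [DirectSum.Decomposition ℳ] [SetLike.GradedSMul 𝒜 ℳ]
    {N : Submodule R M} (hN : N.IsHomogeneous ℳ)
    {m : M} {δ : ℝ} (hm : m ∈ ℳ δ) : (N ⊔ R ∙ m).IsHomogeneous ℳ := by
  intro i u hu
  obtain ⟨n, hn, v, hv, rfl⟩ := Submodule.mem_sup.1 hu
  obtain ⟨r, rfl⟩ := Submodule.mem_span_singleton.1 hv
  rw [decompose_add, DirectSum.add_apply, Submodule.coe_add, decompose_smul_of_mem 𝒜 ℳ _ hm]
  exact add_mem (Submodule.mem_sup_left (hN i hn))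
    (Submodule.mem_sup_right (Submodule.smul_mem _ _ (Submodule.mem_span_singleton_self m)))

/-- A maximal annihilator among those of nonzero homogeneous elements of M/N is prime: if rs kills m
and r does not, the annihilator of rm is no larger than that of m, so s kills m. Homogeneous r and s
suffice because the ideal is homogeneous and the grading is by an ordered group. -/
theorem exists_isPrime_colon (𝒜 : ℝ → Submodule k R) [GradedAlgebra 𝒜]
    (ℳ : ℝ → Submodule k M) [DirectSum.Decomposition ℳ] [SetLike.GradedSMul 𝒜 ℳ] [IsNoetherianRing R] {N : Submodule R M}
    (hN : N.IsHomogeneous ℳ) (hN' : N ≠ ⊤) :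
    ∃ (δ : ℝ) (m : M), m ∈ ℳ δ ∧ m ∉ N ∧ (N.colon {m}).IsPrime := by
  have hne : ∃ (δ : ℝ) (m : M), m ∈ ℳ δ ∧ m ∉ N := by
    by_contra! h
    exact hN' (eq_top_iff.2 fun u _ => (hN.mem_iff ℳ).2 fun i => h i _ (decompose ℳ u i).2)
  let S : Set (Ideal R) := {I | ∃ (δ : ℝ) (m : M), m ∈ ℳ δ ∧ m ∉ N ∧ I = N.colon {m}}
  obtain ⟨I, ⟨δ, m, hm, hmN, rfl⟩, hmax⟩ := set_has_maximal_iff_noetherian.2 ‹IsNoetherianRing R› S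
    (by obtain ⟨δ, m, h, h'⟩ := hne; exact ⟨_, δ, m, h, h', rfl⟩)
  refine ⟨δ, m, hm, hmN, ?_⟩
  refine Ideal.IsHomogeneous.isPrime_of_homogeneous_mem_or_mem (𝒜 := 𝒜) (hN.colon 𝒜 ℳ hm) ?_ ?_
  · rw [Ideal.ne_top_iff_one, Submodule.mem_colon_singleton, one_smul]
    exact hmN
  · rintro r s ⟨i, hr⟩ - hrs
    rw [or_iff_not_imp_left]
    intro hrm
    by_contra hsm
    rw [Submodule.mem_colon_singleton] at hrm hrs hsm
    have hle : N.colon {m} ≤ N.colon {r • m} := fun t ht => by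
      rw [Submodule.mem_colon_singleton] at ht ⊢
      rw [smul_comm]
      exact N.smul_mem r ht
    refine hmax _ ⟨i + δ, r • m, SetLike.GradedSMul.smul_mem hr hm, hrm, rfl⟩
      (lt_of_le_of_ne hle fun h => hsm ?_)
    rw [← Submodule.mem_colon_singleton, h, Submodule.mem_colon_singleton, smul_smul, mul_comm]
    exact hrs

/-- The prime filtration of M, phrased as Noetherian induction downwards from M: the factor (N +
Rm)/N is a shift of R/(N : m). -/
theorem homogeneous_submodule_induction (𝒜 : ℝ → Submodule k R) [GradedAlgebra 𝒜]
    (ℳ : ℝ → Submodule k M) [DirectSum.Decomposition ℳ] [SetLike.GradedSMul 𝒜 ℳ]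
    [IsNoetherianRing R] [Module.Finite R M]
    {motive : Submodule R M → Prop} (top : motive ⊤)
    (step : ∀ (N : Submodule R M) (δ : ℝ) (m : M), N.IsHomogeneous ℳ → m ∈ ℳ δ →
      (N.colon {m}).IsPrime → motive (N ⊔ R ∙ m) → motive N)
    (N : Submodule R M) (hN : N.IsHomogeneous ℳ) : motive N := by
  induction N using WellFoundedGT.induction with
  | ind N ih =>
    by_cases h : N = ⊤
    · exact h ▸ top
    · obtain ⟨δ, m, hm, hmN, hp⟩ := exists_isPrime_colon 𝒜 ℳ hN h
      refine step N δ m hN hm hp (ih _ ?_ (hN.sup_span_singleton 𝒜 ℳ hm))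
      refine lt_of_le_of_ne le_sup_left fun h' => hmN ?_
      rw [h']
      exact Submodule.mem_sup_right (Submodule.mem_span_singleton_self m)

end GradedModule

/-! ### Dimension counts in quotients -/

section Codimension

variable {k R M : Type*} [Field k] [CommRing R] [Algebra k R]
  [AddCommGroup M] [Module k M] [Module R M] [IsScalarTower k R M]

/-- The image of the `k`-subspace `U` in `M ⧸ N`. -/
def imageInQuotient (N : Submodule R M) (U : Submodule k M) : Submodule k (M ⧸ N) :=
  U.map (N.mkQ.restrictScalars k)

theorem mem_imageInQuotient {N : Submodule R M} {U : Submodule k M} {y : M ⧸ N} :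
    y ∈ imageInQuotient N U ↔ ∃ u ∈ U, N.mkQ u = y := Iff.rfl

/-- The image of U in M/N maps onto its image in M/N', with kernel the image of N' ∩ U. -/
theorem imageInQuotient_additive {N N' : Submodule R M} (h : N ≤ N') (U : Submodule k M)
    (h₁ : Module.Finite k (imageInQuotient N (N'.restrictScalars k ⊓ U)))
    (h₂ : Module.Finite k (imageInQuotient N' U)) :
    Module.Finite k (imageInQuotient N U) ∧
      Module.finrank k (imageInQuotient N U) = Module.finrank k (imageInQuotient N' U) +
        Module.finrank k (imageInQuotient N (N'.restrictScalars k ⊓ U)) := by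
  let ψ : (M ⧸ N) →ₗ[k] (M ⧸ N') := (Submodule.factor h).restrictScalars k
  have hψ : ∀ u, ψ (N.mkQ u) = N'.mkQ u := fun u => rfl
  have hmap : (imageInQuotient N U).map ψ = imageInQuotient N' U := by
    ext y
    simp only [Submodule.mem_map, mem_imageInQuotient]
    constructor
    · rintro ⟨_, ⟨u, hu, rfl⟩, rfl⟩
      exact ⟨u, hu, (hψ u).symm⟩
    · rintro ⟨u, hu, rfl⟩
      exact ⟨_, ⟨u, hu, rfl⟩, hψ u⟩
  have hker : imageInQuotient N U ⊓ LinearMap.ker ψ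
      = imageInQuotient N (N'.restrictScalars k ⊓ U) := by
    ext y
    simp only [Submodule.mem_inf, mem_imageInQuotient, LinearMap.mem_ker]
    constructor
    · rintro ⟨⟨u, hu, rfl⟩, h0⟩
      rw [hψ] at h0
      exact ⟨u, ⟨(Submodule.Quotient.mk_eq_zero N').1 h0, hu⟩, rfl⟩
    · rintro ⟨u, ⟨hu', hu⟩, rfl⟩
      exact ⟨⟨u, hu, rfl⟩, (hψ u).trans ((Submodule.Quotient.mk_eq_zero N').2 hu')⟩
  have hfin : Module.Finite k (imageInQuotient N U) := by
    rw [Module.Finite.iff_fg] at h₁ h₂ ⊢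
    exact Submodule.fg_of_fg_map_of_fg_inf_ker ψ (hmap ▸ h₂) (hker ▸ h₁)
  refine ⟨hfin, ?_⟩
  have h3 := LinearMap.finrank_range_add_finrank_ker (ψ.domRestrict (imageInQuotient N U))
  rw [LinearMap.range_domRestrict, hmap, LinearMap.ker_domRestrict] at h3
  rw [← h3, ← hker, ← Submodule.map_comap_subtype]
  congr 1
  exact (LinearEquiv.finrank_eq (Submodule.equivMapOfInjective _
    (Submodule.subtype_injective _) _))

variable (𝒜 : ℝ → Submodule k R) [GradedAlgebra 𝒜]
  (ℳ : ℝ → Submodule k M) [DirectSum.Decomposition ℳ] [SetLike.GradedSMul 𝒜 ℳ]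

/-- Multiplication by `m`, as a map `R ⧸ (N : m) → M ⧸ N`. -/
def colonQuotientMap (N : Submodule R M) (m : M) : (R ⧸ N.colon {m}) →ₗ[R] (M ⧸ N) :=
  Submodule.mapQ (N.colon {m}) N (LinearMap.toSpanSingleton R M m) fun r hr => by
    simpa [Submodule.mem_colon_singleton] using hr

theorem colonQuotientMap_mkQ (N : Submodule R M) (m : M) (r : R) :
    colonQuotientMap N m ((N.colon {m}).mkQ r) = N.mkQ (r • m) := rfl

theorem colonQuotientMap_injective (N : Submodule R M) (m : M) :
    Function.Injective (colonQuotientMap N m) := by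
  rw [injective_iff_map_eq_zero]
  intro y hy
  obtain ⟨r, rfl⟩ := Submodule.mkQ_surjective _ y
  rw [colonQuotientMap_mkQ] at hy
  exact (Submodule.Quotient.mk_eq_zero _).2
    (Submodule.mem_colon_singleton.2 ((Submodule.Quotient.mk_eq_zero N).1 hy))

/-- An element n + rm of degree at most x is unchanged when n and r are truncated separately, and
homogeneity keeps the truncated n in N. Hence high-degree cancellation between n and rm is harmless.
-/
theorem imageInQuotient_sup_span_singleton {N : Submodule R M} (hN : N.IsHomogeneous ℳ) {m : M}
    {δ : ℝ} (hm : m ∈ ℳ δ) (x : ℝ) :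
    imageInQuotient N ((N ⊔ R ∙ m).restrictScalars k ⊓ gradedLE ℳ x) =
      (imageInQuotient (N.colon {m}) (gradedLE 𝒜 (x - δ))).map
        ((colonQuotientMap N m).restrictScalars k) := by
  ext y
  simp only [Submodule.mem_map, mem_imageInQuotient]
  constructor
  · rintro ⟨u, ⟨hu, hux⟩, rfl⟩
    obtain ⟨n, hn, v, hv, rfl⟩ := Submodule.mem_sup.1 hu
    obtain ⟨r, rfl⟩ := Submodule.mem_span_singleton.1 hv
    refine ⟨_, ⟨truncLE 𝒜 (x - δ) r, truncLE_mem_gradedLE 𝒜 _ _, rfl⟩, ?_⟩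
    rw [← truncLE_eq_self ℳ hux, truncLE_add, truncLE_smul_of_mem 𝒜 ℳ _ hm, map_add,
      show N.mkQ (truncLE ℳ x n) = 0 from
        (Submodule.Quotient.mk_eq_zero N).2 (hN.truncLE_mem ℳ x hn), zero_add]
    rfl
  · rintro ⟨_, ⟨r, hr, rfl⟩, rfl⟩
    refine ⟨r • m, ⟨Submodule.mem_sup_right
      (Submodule.smul_mem _ _ (Submodule.mem_span_singleton_self m)), ?_⟩, rfl⟩
    rw [← truncLE_eq_self 𝒜 hr, ← truncLE_smul_of_mem 𝒜 ℳ _ hm]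
    exact truncLE_mem_gradedLE ℳ _ _

theorem imageInQuotient_gradedLE_additive {N : Submodule R M} (hN : N.IsHomogeneous ℳ) {m : M}
    {δ : ℝ} (hm : m ∈ ℳ δ) (x : ℝ)
    (h₁ : Module.Finite k (imageInQuotient (N.colon {m}) (gradedLE 𝒜 (x - δ))))
    (h₂ : Module.Finite k (imageInQuotient (N ⊔ R ∙ m) (gradedLE ℳ x))) :
    Module.Finite k (imageInQuotient N (gradedLE ℳ x)) ∧
      Module.finrank k (imageInQuotient N (gradedLE ℳ x)) =
        Module.finrank k (imageInQuotient (N ⊔ R ∙ m) (gradedLE ℳ x)) +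
        Module.finrank k (imageInQuotient (N.colon {m}) (gradedLE 𝒜 (x - δ))) := by
  have e := Submodule.equivMapOfInjective ((colonQuotientMap N m).restrictScalars k)
    (colonQuotientMap_injective N m) (imageInQuotient (N.colon {m}) (gradedLE 𝒜 (x - δ)))
  rw [← imageInQuotient_sup_span_singleton 𝒜 ℳ hN hm] at e
  rw [e.finrank_eq]
  exact imageInQuotient_additive le_sup_left _ (Module.Finite.equiv e) h₂

end Codimension

/-! ### Hilbert functions of quotients -/

section HilbertFunction

variable {k R M : Type*} [Field k] [CommRing R] [Algebra k R]
  [AddCommGroup M] [Module k M] [Module R M] [IsScalarTower k R M]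

/-- The images of the `M_{≤ x}` in `M ⧸ N` are finite-dimensional, and their dimensions have an
expansion of degree `n` with coefficient `a`. -/
def HasHilbertExpansion (ℳ : ℝ → Submodule k M) (N : Submodule R M) (n : ℕ) (a : ℝ) : Prop :=
  (∀ x, Module.Finite k (imageInQuotient N (gradedLE ℳ x))) ∧
    HasExpansion n a fun x => (Module.finrank k (imageInQuotient N (gradedLE ℳ x)) : ℝ)

theorem finrank_imageInQuotient_gradedLE_monotone (ℳ : ℝ → Submodule k M) (N : Submodule R M)
    (h : ∀ x, Module.Finite k (imageInQuotient N (gradedLE ℳ x))) :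
    Monotone fun x => (Module.finrank k (imageInQuotient N (gradedLE ℳ x)) : ℝ) := by
  intro x y hxy
  have := h y
  exact Nat.cast_le.2 (Submodule.finrank_mono (Submodule.map_mono (gradedLE_mono ℳ hxy)))

theorem HasHilbertExpansion.of_lt {ℳ : ℝ → Submodule k M} {N : Submodule R M} {n m : ℕ} {a : ℝ}
    (h : HasHilbertExpansion ℳ N n a) (hnm : n < m) : HasHilbertExpansion ℳ N m 0 :=
  ⟨h.1, h.2.of_lt hnm⟩

theorem HasHilbertExpansion.top (ℳ : ℝ → Submodule k M) (n : ℕ) :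
    HasHilbertExpansion ℳ (⊤ : Submodule R M) n 0 := by
  have : Subsingleton (M ⧸ (⊤ : Submodule R M)) := Submodule.Quotient.subsingleton_iff.2 rfl
  exact ⟨fun x => inferInstance,
    by simpa [Module.finrank_zero_of_subsingleton] using HasExpansion.zero n⟩

theorem HasHilbertExpansion.of_colon (𝒜 : ℝ → Submodule k R) [GradedAlgebra 𝒜]
    (ℳ : ℝ → Submodule k M) [DirectSum.Decomposition ℳ] [SetLike.GradedSMul 𝒜 ℳ]
    {N : Submodule R M} (hN : N.IsHomogeneous ℳ) {m : M} {δ : ℝ} (hm : m ∈ ℳ δ) {n : ℕ} {a a' : ℝ}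
    (h : HasHilbertExpansion ℳ (N ⊔ R ∙ m) n a)
    (h' : HasHilbertExpansion 𝒜 (N.colon {m}) n a') : HasHilbertExpansion ℳ N n (a + a') := by
  have key := fun x => imageInQuotient_gradedLE_additive 𝒜 ℳ hN hm x (h'.1 _) (h.1 x)
  refine ⟨fun x => (key x).1, ?_⟩
  have := h.2.add (h'.2.comp_sub_const δ)
  convert this using 2 with x
  exact_mod_cast (key x).2

theorem Submodule.IsHomogeneous.bot {k R M : Type*} [Field k] [CommRing R] [AddCommGroup M]
    [Module k M] [Module R M] (ℳ : ℝ → Submodule k M) [DirectSum.Decomposition ℳ] :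
    (⊥ : Submodule R M).IsHomogeneous ℳ := by
  intro i u hu
  rw [show u = 0 from hu]
  simp

theorem gradedLE_eq_bot {ℳ : ℝ → Submodule k M} (h : ∀ γ : ℝ, γ < 0 → ℳ γ = ⊥) {x : ℝ}
    (hx : x < 0) : gradedLE ℳ x = ⊥ :=
  eq_bot_iff.2 (iSup₂_le fun l hl => (h l (hl.trans_lt hx)).le)

theorem finrank_imageInQuotient_gradedLE_eq_zero {ℳ : ℝ → Submodule k M}
    (h : ∀ γ : ℝ, γ < 0 → ℳ γ = ⊥) (N : Submodule R M) {x : ℝ} (hx : x < 0) :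
    Module.finrank k (imageInQuotient N (gradedLE ℳ x)) = 0 := by
  rw [gradedLE_eq_bot h hx, imageInQuotient, Submodule.map_bot, finrank_bot]

/-- `imageInQuotient ⊥ U` is isomorphic to `U`. -/
noncomputable def imageInQuotientBotEquiv (R : Type*) [CommRing R] [Algebra k R] [Module R M]
    [IsScalarTower k R M] (U : Submodule k M) :
    U ≃ₗ[k] imageInQuotient (⊥ : Submodule R M) U :=
  Submodule.equivMapOfInjective ((⊥ : Submodule R M).mkQ.restrictScalars k)
    (show Function.Injective (⊥ : Submodule R M).mkQ from
      LinearMap.ker_eq_bot.1 (Submodule.ker_mkQ _)) U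

end HilbertFunction

/-! ### Quotients by homogeneous primes -/

section Prime

variable {k R : Type*} [Field k] [CommRing R] [Algebra k R]
  (𝒜 : ℝ → Submodule k R)

/-- Only the constants survive modulo p. -/
theorem HasHilbertExpansion.of_forall_pos_mem (h_neg : ∀ γ : ℝ, γ < 0 → 𝒜 γ = ⊥)
    (h_zero : 𝒜 0 = (1 : Submodule k R)) (p : Ideal R)
    (h : ∀ d : ℝ, 0 < d → ∀ f ∈ 𝒜 d, f ∈ p) :
    ∃ a, HasHilbertExpansion 𝒜 p 0 a := by
  have hle : ∀ x, gradedLE 𝒜 x ≤ (1 : Submodule k R) ⊔ p.restrictScalars k := fun x =>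
    iSup₂_le fun l _ => by
      rcases lt_trichotomy l 0 with hl | rfl | hl
      · rw [h_neg l hl]; exact bot_le
      · rw [h_zero]; exact le_sup_left
      · exact le_trans (fun f hf => h l hl f hf) le_sup_right
  have hle' : ∀ x, imageInQuotient p (gradedLE 𝒜 x) ≤ imageInQuotient p (1 : Submodule k R) := by
    rintro x _ ⟨u, hu, rfl⟩
    obtain ⟨c, hc, q, hq, rfl⟩ := Submodule.mem_sup.1 (hle x hu)
    refine ⟨c, hc, ?_⟩
    rw [map_add]
    exact (add_eq_left.2 ((Submodule.Quotient.mk_eq_zero p).2 hq)).symm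
  have hfin1 : Module.Finite k (imageInQuotient p (1 : Submodule k R)) := by
    rw [Module.Finite.iff_fg]
    exact Submodule.FG.map _ (by rw [Submodule.one_eq_span]; exact Submodule.fg_span_singleton 1)
  have hfin : ∀ x, Module.Finite k (imageInQuotient p (gradedLE 𝒜 x)) := fun x =>
    Submodule.finiteDimensional_of_le (hle' x)
  refine ⟨Module.finrank k (imageInQuotient p (1 : Submodule k R)), hfin,
    HasExpansion.of_const_on_nonneg _ (finrank_imageInQuotient_gradedLE_monotone 𝒜 p hfin)
      fun x hx => ?_⟩
  have : imageInQuotient p (gradedLE 𝒜 x) = imageInQuotient p (1 : Submodule k R) :=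
    le_antisymm (hle' x) (Submodule.map_mono (h_zero ▸ le_iSup₂_of_le (0 : ℝ) hx le_rfl))
  rw [this]

variable [GradedAlgebra 𝒜]

/-- Primality gives (p : f) = p, which turns additivity into the difference equation of
`HasExpansion.of_step`. -/
theorem HasHilbertExpansion.of_sup_span_singleton (h_neg : ∀ γ : ℝ, γ < 0 → 𝒜 γ = ⊥)
    {p : Ideal R} [p.IsPrime] (hp : Submodule.IsHomogeneous p 𝒜) {d : ℝ} (hd : 0 < d) {f : R}
    (hf : f ∈ 𝒜 d) (hfp : f ∉ p) {n : ℕ} {a : ℝ}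
    (h : HasHilbertExpansion 𝒜 (p ⊔ R ∙ f) n a) :
    HasHilbertExpansion 𝒜 p (n + 1) (a / d) := by
  have hcolon : Submodule.colon p {f} = p := by
    ext r
    rw [Submodule.mem_colon_singleton, smul_eq_mul]
    exact ⟨fun hr => (Ideal.IsPrime.mem_or_mem ‹_› hr).resolve_right hfp, p.mul_mem_right f⟩
  have key := fun x => imageInQuotient_gradedLE_additive 𝒜 𝒜 hp hf x
  rw [hcolon] at key
  replace key := fun x h1 => key x h1 (h.1 x)
  -- Finiteness spreads from x < 0, where the space is zero, by d at a time.
  have hfin' : ∀ (j : ℕ) (x : ℝ), x < j * d →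
      Module.Finite k (imageInQuotient p (gradedLE 𝒜 x)) := by
    intro j
    induction j with
    | zero =>
      intro x hx
      rw [gradedLE_eq_bot h_neg (by simpa using hx), imageInQuotient, Submodule.map_bot]
      infer_instance
    | succ j ih =>
      intro x hx
      push_cast at hx
      exact (key x (ih _ (by linarith))).1
  have hfin : ∀ x, Module.Finite k (imageInQuotient p (gradedLE 𝒜 x)) := by
    intro x
    obtain ⟨j, hj⟩ := exists_nat_gt (x / d)
    exact hfin' j x ((div_lt_iff₀ hd).1 hj)
  refine ⟨hfin, HasExpansion.of_step hd (finrank_imageInQuotient_gradedLE_monotone 𝒜 p hfin)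
    (fun x hx => ?_) h.2 fun x => ?_⟩
  · rw [finrank_imageInQuotient_gradedLE_eq_zero h_neg p hx, Nat.cast_zero]
  · exact_mod_cast (key x (hfin _)).2

/-- The degree-zero part of rf is the degree -d part of r times f, hence zero; so 1 in p + (f) would
force 1 in p. -/
theorem sup_span_singleton_ne_top (h_neg : ∀ γ : ℝ, γ < 0 → 𝒜 γ = ⊥)
    {p : Ideal R} (hp : Submodule.IsHomogeneous p 𝒜) (hp' : p ≠ ⊤) {d : ℝ} (hd : 0 < d) {f : R}
    (hf : f ∈ 𝒜 d) : p ⊔ R ∙ f ≠ ⊤ := by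
  intro h
  have h1 : (1 : R) ∈ p ⊔ R ∙ f := h ▸ Submodule.mem_top
  obtain ⟨q, hq, v, hv, hqv⟩ := Submodule.mem_sup.1 h1
  obtain ⟨r, rfl⟩ := Submodule.mem_span_singleton.1 hv
  have h2 : (decompose 𝒜 (r • f) 0 : R) = 0 := by
    rw [decompose_smul_of_mem 𝒜 𝒜 r hf]
    have : (decompose 𝒜 r (0 - d) : R) ∈ (⊥ : Submodule k R) :=
      h_neg (0 - d) (by linarith) ▸ (decompose 𝒜 r (0 - d)).2
    rw [(Submodule.mem_bot k).1 this, zero_smul]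
  have h3 : (decompose 𝒜 (1 : R) 0 : R) = 1 := decompose_of_mem_same 𝒜 SetLike.GradedOne.one_mem
  rw [← hqv, decompose_add, DirectSum.add_apply, Submodule.coe_add, h2, add_zero, hqv] at h3
  exact hp' ((Ideal.eq_top_iff_one p).2 (h3 ▸ hp 0 hq))

/-- Induction on the dimension of R/p. Only an upper bound is assumed, since primes in the
filtration can have any smaller coheight. -/
theorem exists_hasHilbertExpansion_of_coheight_le [IsNoetherianRing R]
    (h_neg : ∀ γ : ℝ, γ < 0 → 𝒜 γ = ⊥) (h_zero : 𝒜 0 = (1 : Submodule k R)) (n : ℕ)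
    (p : PrimeSpectrum R) (hp : Submodule.IsHomogeneous p.asIdeal 𝒜)
    (hn : Order.coheight p ≤ n) : ∃ a, HasHilbertExpansion 𝒜 p.asIdeal n a := by
  induction n generalizing p with
  | zero =>
    refine HasHilbertExpansion.of_forall_pos_mem 𝒜 h_neg h_zero _ fun d hd f hf => ?_
    by_contra hfp
    obtain ⟨q, hq, hle⟩ := Ideal.exists_le_maximal _
      (sup_span_singleton_ne_top 𝒜 h_neg hp p.isPrime.ne_top hd hf)
    have hmax : IsMax p := Order.coheight_eq_zero.1 (nonpos_iff_eq_zero.1 (by simpa using hn))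
    have hqp : q ≤ p.asIdeal :=
      hmax (b := ⟨q, hq.isPrime⟩) (show p.asIdeal ≤ q from le_sup_left.trans hle)
    exact hfp (hqp (hle (Submodule.mem_sup_right (Submodule.mem_span_singleton_self f))))
  | succ n ih =>
    by_cases h : ∀ d : ℝ, 0 < d → ∀ f ∈ 𝒜 d, f ∈ p.asIdeal
    · obtain ⟨a, ha⟩ := HasHilbertExpansion.of_forall_pos_mem 𝒜 h_neg h_zero p.asIdeal h
      exact ⟨0, ha.of_lt n.succ_pos⟩
    · push Not at h
      obtain ⟨d, hd, f, hf, hfp⟩ := h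
      have key : ∃ a, HasHilbertExpansion 𝒜 (p.asIdeal ⊔ R ∙ f) n a := by
        -- The motive remembers p + (f) ≤ N, so every colon prime contains f and lies strictly above
        -- p.
        refine homogeneous_submodule_induction 𝒜 𝒜
          (motive := fun N => p.asIdeal ⊔ R ∙ f ≤ N → ∃ a, HasHilbertExpansion 𝒜 N n a)
          (fun _ => ⟨0, HasHilbertExpansion.top 𝒜 n⟩) (fun N δ m hN hm hq hind hle => ?_)
          (p.asIdeal ⊔ R ∙ f) (hp.sup_span_singleton 𝒜 𝒜 hf) le_rfl
        obtain ⟨a, ha⟩ := hind (hle.trans le_sup_left)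
        have hNq : N ≤ N.colon {m} := fun r hr =>
          Submodule.mem_colon_singleton.2 (Ideal.mul_mem_right m N hr)
        have hlt : p < ⟨N.colon {m}, hq⟩ := by
          refine lt_of_le_not_ge (show p.asIdeal ≤ _ from le_sup_left.trans (hle.trans hNq))
            fun hge => hfp (hge (hNq (hle ?_)))
          exact Submodule.mem_sup_right (Submodule.mem_span_singleton_self f)
        have hco := Order.coheight_le_coe_iff.1 hn _ hlt
        obtain ⟨a', ha'⟩ := ih ⟨N.colon {m}, hq⟩ (hN.colon 𝒜 𝒜 hm)
          (Order.le_of_lt_succ (by simpa [Order.succ_eq_add_one] using hco))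
        exact ⟨_, HasHilbertExpansion.of_colon 𝒜 𝒜 hN hm ha ha'⟩
      obtain ⟨a, ha⟩ := key
      exact ⟨_, ha.of_sup_span_singleton 𝒜 h_neg hp hd hf hfp⟩

end Prime

/-! ### Additivity of the rank -/

section Rank

variable {R M : Type*} [CommRing R] [IsDomain R] [AddCommGroup M] [Module R M] [Module.Finite R M]

/-- Multiplication by m identifies R/(N : m) with (N + Rm)/N. -/
theorem finrank_quotient_eq_add_finrank_quotient_colon (N : Submodule R M) (m : M) :
    Module.finrank R (M ⧸ N) =
      Module.finrank R (M ⧸ (N ⊔ R ∙ m)) + Module.finrank R (R ⧸ N.colon {m}) := by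
  have h1 := Submodule.finrank_quotient_add_finrank (Submodule.map N.mkQ (N ⊔ R ∙ m))
  rw [(Submodule.quotientQuotientEquivQuotient N _ le_sup_left).finrank_eq] at h1
  have h2 : LinearMap.range (colonQuotientMap N m) = Submodule.map N.mkQ (N ⊔ R ∙ m) := by
    rw [Submodule.map_sup, Submodule.map_span, Set.image_singleton,
      show Submodule.map N.mkQ N = ⊥ from by simp, bot_sup_eq]
    ext y
    rw [LinearMap.mem_range, Submodule.mem_span_singleton]
    constructor
    · rintro ⟨z, rfl⟩
      obtain ⟨r, rfl⟩ := Submodule.mkQ_surjective _ z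
      exact ⟨r, rfl⟩
    · rintro ⟨r, rfl⟩
      exact ⟨(N.colon {m}).mkQ r, rfl⟩
  rw [← h1, ← h2, LinearMap.finrank_range_of_inj (colonQuotientMap_injective N m)]

theorem finrank_quotient_ideal_eq_zero {I : Ideal R} (hI : I ≠ ⊥) :
    Module.finrank R (R ⧸ I) = 0 := by
  rw [Module.finrank_eq_zero_iff_isTorsion]
  obtain ⟨r, hr, hr0⟩ := Submodule.exists_mem_ne_zero_of_ne_bot hI
  intro y
  obtain ⟨s, rfl⟩ := Submodule.mkQ_surjective _ y
  refine ⟨⟨r, mem_nonZeroDivisors_of_ne_zero hr0⟩, ?_⟩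
  exact (Submodule.Quotient.mk_eq_zero I).2 (I.mul_mem_right s hr)

end Rank

/-! ### The main theorem -/

theorem mainTheorem5 {k R M : Type*} [Field k] [IsAlgClosed k]
    [CommRing R] [IsDomain R] [Algebra k R] [Algebra.FiniteType k R]
    (𝒜 : ℝ → Submodule k R) [GradedAlgebra 𝒜]
    (h𝒜_neg : ∀ γ : ℝ, γ < 0 → 𝒜 γ = ⊥)
    (h𝒜_zero : 𝒜 0 = (1 : Submodule k R))
    (n : ℕ) (hn : ringKrullDim R = n)
    [AddCommGroup M] [Module k M] [Module R M] [IsScalarTower k R M] [Module.Finite R M]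
    (ℳ : ℝ → Submodule k M) [DirectSum.Decomposition ℳ] [SetLike.GradedSMul 𝒜 ℳ] :
    (∀ x : ℝ, Module.Finite k (gradedLE 𝒜 x)) ∧
    (∀ x : ℝ, Module.Finite k (gradedLE ℳ x)) ∧
    ∃ aR aM bM : ℝ,
      HasLeadingTerm (dimLE 𝒜) n aR ∧
      HasLeadingTerm (dimLE ℳ) n aM ∧
      (1 ≤ n → HasCesaroSecondTerm (dimLE ℳ) n aM bM) ∧
      aM = (Module.finrank R M : ℝ) * aR := by
  have : IsNoetherianRing R := Algebra.FiniteType.isNoetherianRing k R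
  have hco : ∀ p : PrimeSpectrum R, Order.coheight p ≤ n := fun p => by
    have h := (Order.coheight_le_krullDim p).trans_eq hn
    exact_mod_cast h
  obtain ⟨aR, haR⟩ := exists_hasHilbertExpansion_of_coheight_le 𝒜 h𝒜_neg h𝒜_zero n ⊥
    (Submodule.IsHomogeneous.bot 𝒜) (hco ⊥)
  have hM : HasHilbertExpansion ℳ (⊥ : Submodule R M) n
      (Module.finrank R (M ⧸ (⊥ : Submodule R M)) * aR) := by
    refine homogeneous_submodule_induction 𝒜 ℳ
      (motive := fun N => HasHilbertExpansion ℳ N n (Module.finrank R (M ⧸ N) * aR))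
      ?_ (fun N δ m hN hm hp h => ?_) ⊥ (Submodule.IsHomogeneous.bot ℳ)
    · have : Subsingleton (M ⧸ (⊤ : Submodule R M)) :=
        Submodule.Quotient.subsingleton_iff.2 rfl
      simpa [Module.finrank_zero_of_subsingleton] using HasHilbertExpansion.top (R := R) ℳ n
    · rw [finrank_quotient_eq_add_finrank_quotient_colon N m, Nat.cast_add, add_mul]
      refine HasHilbertExpansion.of_colon 𝒜 ℳ hN hm h ?_
      by_cases hbot : N.colon {m} = ⊥
      · rw [hbot, (Submodule.quotEquivOfEqBot (⊥ : Ideal R) rfl).finrank_eq, Module.finrank_self,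
          Nat.cast_one, one_mul]
        exact haR
      · rw [finrank_quotient_ideal_eq_zero hbot, Nat.cast_zero, zero_mul]
        -- A nonzero prime has coheight c < n, so its factor expands in degree c and adds nothing to
        -- the coefficient of x^n.
        have hlt : (⊥ : PrimeSpectrum R) < ⟨N.colon {m}, hp⟩ :=
          bot_lt_iff_ne_bot.2 fun h => hbot (congrArg PrimeSpectrum.asIdeal h)
        have hlt' := Order.coheight_le_coe_iff.1 (hco ⊥) _ hlt
        obtain ⟨c, hc⟩ := ENat.ne_top_iff_exists.1 hlt'.ne_top
        rw [← hc, Nat.cast_lt] at hlt'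
        obtain ⟨a, ha⟩ := exists_hasHilbertExpansion_of_coheight_le 𝒜 h𝒜_neg h𝒜_zero c _
          (hN.colon 𝒜 ℳ hm) hc.ge
        exact ha.of_lt hlt'
  have eR : dimLE 𝒜 = fun x =>
      (Module.finrank k (imageInQuotient (⊥ : Submodule R R) (gradedLE 𝒜 x)) : ℝ) :=
    funext fun x => congrArg Nat.cast (imageInQuotientBotEquiv R (gradedLE 𝒜 x)).finrank_eq
  have eM : dimLE ℳ = fun x =>
      (Module.finrank k (imageInQuotient (⊥ : Submodule R M) (gradedLE ℳ x)) : ℝ) :=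
    funext fun x => congrArg Nat.cast (imageInQuotientBotEquiv R (gradedLE ℳ x)).finrank_eq
  rw [(Submodule.quotEquivOfEqBot (⊥ : Submodule R M) rfl).finrank_eq] at hM
  obtain ⟨bM, hbM⟩ := hM.2.exists_hasCesaroSecondTerm
  refine ⟨fun x => ?_, fun x => ?_, aR, _, bM, ?_, ?_, ?_, rfl⟩
  · have := haR.1 x
    exact Module.Finite.equiv (imageInQuotientBotEquiv R (gradedLE 𝒜 x)).symm
  · have := hM.1 x
    exact Module.Finite.equiv (imageInQuotientBotEquiv R (gradedLE ℳ x)).symm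
  · rw [eR]
    exact haR.2.hasLeadingTerm
  · rw [eM]
    exact hM.2.hasLeadingTerm
  · rw [eM]
    exact hbM
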